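/- **Setting.** Let $1\le L\le N$ be integers and let $i_1,\dots,i_{N_{\rm B}}\in\{0,\dots,N-1\}$ be distinct subcarrier indices. Bob and Ava use activation patterns (codewords) ${\bf c}_{\rm B},{\bf c}_{\rm A}\in\{0,1\}^{N_{\rm B}}$, which may be arbitrary binary words, in particular any two codewords of an independence-checking code. On subcarrier $i_b$ Bob sends $x_{{\rm B},b}=\sqrt{\rho_{\rm B}}e^{j\phi}$ if $c_{{\rm B},b}=1$ and $0$ otherwise; Ava sends $x_{{\rm A},b}=\sqrt{\rho_{\rm A}}e^{j\varphi_b}$ if $c_{{\rm A},b}=1$ and $0$ otherwise. Here $\rho_{\rm B},\rho_{\rm A}>0$, and the phases $\phi,\varphi_b$ are arbitrary, possibly random. Antenna $m=1,2,\dots$ of the base station receives $$y_{b,m}=x_{{\rm B},b}({\bf F}_{\rm L}{\bf h}_{\rm B}^m)_{i_b}+x_{{\rm A},b}({\bf F}_{\rm L}{\bf h}_{\rm A}^m)_{i_b}+({\bf F}{\bf v}^m)_{i_b},$$ where ${\bf F}$ is the unitary $N\times N$ DFT matrix and ${\bf F}_{\rm L}$ is $\sqrt N$ times its first $L$ columns.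 The families ${\bf h}_{\rm B}$, ${\bf h}_{\rm A}$, ${\bf v}$ are independent of each other and each is a zero-mean circularly symmetric complex Gaussian family. The entries of ${\bf v}$ are i.i.d. with variance $\sigma^2\ge 0$. Different paths are uncorrelated, and for every path the correlation between antennas $m,n$ is the one-ring correlation $$\frac1{2\Delta L}\int_{\theta-\Delta}^{\theta+\Delta}e^{-j2\pi D(m-n)\sin\alpha}\,d\alpha,$$ with $\theta=\theta_1$ for Bob and $\theta=\theta_2$ for Ava, where $D>0$, $\Delta>0$ and $[\theta_k-\Delta,\theta_k+\Delta]\subseteq[-\pi/3,\pi/3]$. **Decoder.** The observed codeword is the number $o_b=c_{{\rm B},b}+c_{{\rm A},b}$ of nodes transmitting on each subcarrier; $b$ is ambiguous if $o_b=1$. Let $r$ be any ambiguous reference position (any position if none is ambiguous). For each ambiguous $b$ the base station measures the inner product exactly under massive antennas, that is, it obtains $$I_{r,b}=\lim_{n\to\infty}\Big\langle \frac{{\bf y}_r^{(n)}}{\|{\bf y}_r^{(n)}\|},\frac{{\bf y}_b^{(n)}}{\|{\bf y}_b^{(n)}\|}\Big\rangle ,\qquad {\bf y}_b^{(n)}=(y_{b,1},\dots,y_{b,n}),$$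 and puts $d_{r,b}=f_d(|I_{r,b}|)\oplus1$ with $f_d(x)=1$ if $x>0$ and $f_d(x)=0$ otherwise. For $a\in\{0,1\}$ the candidate $\overline{\bf c}_a$ has digit $0$ where $o_b=0$, digit $1$ where $o_b=2$, and digit $d_{r,b}\oplus a$ where $b$ is ambiguous. The separation error probability (SEP) is the probability that one of the limits fails to exist or that $\{\overline{\bf c}_0,\overline{\bf c}_1\}\ne\{{\bf c}_{\rm B},{\bf c}_{\rm A}\}$. **Proposition 2.** Assume that $N\nmid L(i_r-i_b)$ for every ambiguous $b\neq r$ on which the same node transmits as on $r$ (so that this node's channels on the two subcarriers are correlated). Then the SEP is zero. -/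

import Mathlib

open MeasureTheory ProbabilityTheory Filter Topology

noncomputable section

namespace ICC

/-! ### Codewords, superposition, and the differential decoder -/

/-- A binary word of length `NB`; digit `true` means that the subcarrier is activated. -/
abbrev Codeword (NB : ℕ) : Type := Fin NB → Bool

/-- The superimposed codeword observed at the base station: the number of nodes
(none, one or two) that transmit on each subcarrier. -/
def observed {NB : ℕ} (cB cA : Codeword NB) : Fin NB → ℕ :=
  fun b => (cB b).toNat + (cA b).toNat

/-- The ambiguous subcarriers of an observation: exactly one (unknown) node transmits. -/
def ambiguous {NB : ℕ} (o : Fin NB → ℕ) : Finset (Fin NB) :=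
  Finset.univ.filter fun b => o b = 1

/-- The threshold decision with threshold zero. -/
def thresholdDigit (x : ℝ) : Bool := decide (0 < x)

/-- The differential digit (threshold decision plus one, modulo two) of a measured
inner product. -/
def diffDigit (I : ℂ) : Bool := xor (thresholdDigit ‖I‖) true

/-- The candidate codeword output under the assumption that the digit of the reference
subcarrier equals `a`. The decoder sees only the observed codeword `o` and the measured
inner products `I b` between the reference subcarrier and the subcarriers `b`. -/
def candidate {NB : ℕ} (o : Fin NB → ℕ) (I : Fin NB → ℂ) (a : Bool) : Codeword NB :=
  fun b => if o b = 0 then false else if o b = 2 then true else xor (diffDigit (I b)) a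

/-- The unordered pair of words into which the decoder separates the observation. -/
def separatedPair {NB : ℕ} (o : Fin NB → ℕ) (I : Fin NB → ℂ) : Sym2 (Codeword NB) :=
  s(candidate o I false, candidate o I true)

/-! ### The OFDM signal model -/

/-- The unitary `N × N` DFT matrix. -/
def dft (N : ℕ) : Matrix (Fin N) (Fin N) ℂ :=
  Matrix.of fun j t =>
    Complex.exp (-(2 * Real.pi * Complex.I * (j : ℕ) * (t : ℕ) / N)) / (Real.sqrt N : ℂ)

/-- `√N` times the first `L` columns of the DFT matrix. -/
def dftL {N L : ℕ} (hLN : L ≤ N) : Matrix (Fin N) (Fin L) ℂ :=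
  (Real.sqrt N : ℂ) • (dft N).submatrix id (Fin.castLE hLN)

/-- The transmitted symbol for a digit: a pilot tone of power `ρ` and phase `φ` if the digit is
one, silence otherwise. -/
def pilot (digit : Bool) (ρ φ : ℝ) : ℂ :=
  if digit then (Real.sqrt ρ : ℂ) * Complex.exp (Complex.I * φ) else 0

/-- Frequency-domain sample at subcarrier `j` of one antenna: `xB`, `xA` are the symbols sent on
this subcarrier, `hB`, `hA` the channel impulse responses to this antenna, and `v` the
time-domain noise vector of this antenna. -/
def received {N L : ℕ} (hLN : L ≤ N) (j : Fin N) (xB xA : ℂ)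
    (hB hA : Fin L → ℂ) (v : Fin N → ℂ) : ℂ :=
  xB * (dftL hLN).mulVec hB j + xA * (dftL hLN).mulVec hA j + (dft N).mulVec v j

/-- Inner product of the normalized received vectors of the first `n` antennas, for the samples
`y` on one subcarrier and `z` on another. -/
def normalizedInner (y z : ℕ → ℂ) (n : ℕ) : ℂ :=
  let u : EuclideanSpace ℂ (Fin n) := WithLp.toLp 2 fun i => y i
  let w : EuclideanSpace ℂ (Fin n) := WithLp.toLp 2 fun i => z i
  inner ℂ ((‖u‖ : ℂ)⁻¹ • u) ((‖w‖ : ℂ)⁻¹ • w)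

/-! ### Fading and noise -/

/-- `X` is a zero-mean circularly symmetric complex Gaussian family with covariance
`E[X s * conj (X t)] = K s t`. -/
structure IsCircularGaussian {Ω T : Type*} [MeasurableSpace Ω] (X : T → Ω → ℂ)
    (K : T → T → ℂ) (μ : Measure Ω) : Prop where
  measurable : ∀ t, Measurable (X t)
  gaussian : IsGaussianProcess X μ
  mean : ∀ t, ∫ ω, X t ω ∂μ = 0
  covariance : ∀ s t, ∫ ω, X s ω * star (X t ω) ∂μ = K s t
  pseudoCovariance : ∀ s t, ∫ ω, X s ω * X t ω ∂μ = 0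

/-- One-ring correlation between antennas `m` and `n` of a uniform linear array with spacing `D`
(in wavelengths), for mean angle of arrival `θ`, angular spread `Δ` and `L` paths. -/
def oneRing (D Δ θ : ℝ) (L : ℕ) (m n : ℕ) : ℂ :=
  (1 / (2 * Δ * L) : ℂ) * ∫ α in (-Δ + θ)..(Δ + θ),
    Complex.exp (-(Complex.I * 2 * Real.pi * D * ((m : ℂ) - n) * Real.sin α))

/-- Covariance of the taps `(antenna, path)`: paths are uncorrelated and equally strong
(power `1 / L` each), antennas are correlated by the one-ring model. -/
def channelCov (D Δ θ : ℝ) (L : ℕ) (p q : ℕ × Fin L) : ℂ :=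
  if p.2 = q.2 then oneRing D Δ θ L p.1 q.1 else 0

/-- Covariance of white noise of power `σ2`, indexed by `(antenna, sample)`. -/
def noiseCov (σ2 : ℝ) (N : ℕ) (p q : ℕ × Fin N) : ℂ :=
  if p = q then (σ2 : ℂ) else 0

/-- Joint law of the channels `hB`, `hA` of the two nodes and of the noise `v`: Rayleigh fading
with one-ring correlation, white Gaussian noise, and independence of the three families. -/
structure IsFadingModel {Ω : Type*} [MeasurableSpace Ω] (μ : Measure Ω) {N L : ℕ}
    (D Δ θB θA σ2 : ℝ) (hB hA : ℕ × Fin L → Ω → ℂ) (v : ℕ × Fin N → Ω → ℂ) : Prop where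
  bob : IsCircularGaussian hB (channelCov D Δ θB L) μ
  ava : IsCircularGaussian hA (channelCov D Δ θA L) μ
  noise : IsCircularGaussian v (noiseCov σ2 N) μ
  indep_channels : IndepFun (fun ω p => hB p ω) (fun ω p => hA p ω) μ
  indep_noise :
    IndepFun (fun ω => ((fun p => hB p ω), (fun p => hA p ω))) (fun ω p => v p ω) μ

/-- The sample received at antenna `i` on the `b`-th pilot subcarrier `Ψ b`, when Bob uses the
activation pattern `cB` with phase `φB` and Ava the pattern `cA` with phases `φA b`. -/
def sample {Ω : Type*} {N L NB : ℕ} (hLN : L ≤ N) (Ψ : Fin NB ↪ Fin N) (ρB ρA : ℝ)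
    (cB cA : Codeword NB) (φB : Ω → ℝ) (φA : Fin NB → Ω → ℝ)
    (hB hA : ℕ × Fin L → Ω → ℂ) (v : ℕ × Fin N → Ω → ℂ) (b : Fin NB) (ω : Ω) (i : ℕ) : ℂ :=
  received hLN (Ψ b) (pilot (cB b) ρB (φB ω)) (pilot (cA b) ρA (φA b ω))
    (fun l => hB (i, l) ω) (fun l => hA (i, l) ω) (fun t => v (i, t) ω)

/-! ### The separation error probability -/

/-- Successful separation with reference subcarrier `r`, for the samples `y b i` (subcarrier `b`,
antenna `i`): the inner products between the reference and the ambiguous subcarriers have exact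
(massive-array) values `I`, and decoding with these returns the two right codewords. -/
def Separated {NB : ℕ} (cB cA : Codeword NB) (r : Fin NB) (y : Fin NB → ℕ → ℂ) : Prop :=
  ∃ I : Fin NB → ℂ,
    (∀ b ∈ ambiguous (observed cB cA),
      Tendsto (normalizedInner (y r) (y b)) atTop (𝓝 (I b))) ∧
    separatedPair (observed cB cA) I = s(cB, cA)

/-- The separation error probability. -/
def sep {Ω : Type*} [MeasurableSpace Ω] (μ : Measure Ω) {NB : ℕ} (cB cA : Codeword NB)
    (r : Fin NB) (y : Fin NB → Ω → ℕ → ℂ) : ENNReal :=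
  μ {ω | ¬ Separated cB cA r (fun b => y b ω)}

end ICC

end

/-!
On an arc of incidence angles where the cosine does not vanish, the phase of the one-ring integral
has no critical point, so the correlation between two antennas decays like the inverse of their
distance. The rows of the covariance are therefore uniformly square summable, and the Isserlis
formula bounds the variance of a sum of `n` squares of the Gaussian variables by a multiple of `n`.
A strong law of large numbers follows: almost surely the empirical correlations across the antennas
of all pairs of sources (paths and noise samples) converge to their covariances. There are finitely
many pairs, so one null set serves all of them, and off it the pilot phases may depend on the
outcome in any way.

A received sample is a linear combination of the sources, with weights that do not depend on the
antenna. The inner product of two ambiguous subcarriers `r`, `b` therefore converges; its limit is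
zero when different nodes transmit on them. When the same node does, the limit is a nonzero multiple
of a geometric sum with ratio an `N`-th root of unity raised to the power `i_r - i_b`, and this sum
vanishes only if `N` divides `L (i_r - i_b)`. Thresholding at zero thus tells on each ambiguous
subcarrier whether the transmitter is the one of the reference.
-/

noncomputable section

namespace ICC

section GaussianMoments

lemma iteratedDeriv_succ_id_mul_zero {f : ℝ → ℝ} {n : ℕ} (hf : ContDiff ℝ (n + 1) f) :
    iteratedDeriv (n + 1) (fun t => t * f t) 0 = (n + 1) * iteratedDeriv n f 0 := by
  rw [iteratedDeriv_fun_mul contDiffAt_id (by exact_mod_cast hf.contDiffAt),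
    Finset.sum_eq_single_of_mem 1 (by simp) fun i _ hi => by simp [iteratedDeriv_fun_id_zero, hi]]
  simp

lemma integral_pow_add_two_gaussianReal (v : NNReal) (n : ℕ) :
    ∫ x, x ^ (n + 2) ∂(gaussianReal 0 v) = (n + 1) * v * ∫ x, x ^ n ∂(gaussianReal 0 v) := by
  have hmoment (k : ℕ) : ∫ x, x ^ k ∂(gaussianReal 0 v) =
      iteratedDeriv k (fun t : ℝ => Real.exp (v * t ^ 2 / 2)) 0 := by
    have h := iteratedDeriv_mgf_zero (X := fun x : ℝ => x) (μ := gaussianReal 0 v) (by simp) k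
    rw [mgf_fun_id_gaussianReal] at h
    simpa using h.symm
  have hderiv : deriv (fun t : ℝ => Real.exp (v * t ^ 2 / 2)) =
      fun t => v * (t * Real.exp (v * t ^ 2 / 2)) := by
    ext t
    have h : HasDerivAt (fun t : ℝ => v * t ^ 2 / 2) (v * t) t :=
      (((hasDerivAt_pow 2 t).const_mul (v : ℝ)).div_const 2).congr_deriv (by push_cast; ring)
    rw [h.exp.deriv]
    ring
  rw [hmoment, hmoment, iteratedDeriv_succ', hderiv, iteratedDeriv_const_mul_field,
    iteratedDeriv_succ_id_mul_zero (by fun_prop)]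
  ring

lemma integral_pow_four_gaussianReal (v : NNReal) :
    ∫ x, x ^ 4 ∂(gaussianReal 0 v) = 3 * (v : ℝ) ^ 2 := by
  rw [integral_pow_add_two_gaussianReal, integral_pow_add_two_gaussianReal]
  simp only [pow_zero, integral_const, probReal_univ, smul_eq_mul]
  push_cast
  ring

variable {Ω : Type*} [MeasurableSpace Ω] {μ : Measure Ω} {G H : Ω → ℝ}

lemma memLp_two_sq_of_hasGaussianLaw (hG : HasGaussianLaw G μ) :
    MemLp (fun ω => G ω ^ 2) 2 μ := by
  have h := (hG.memLp (p := 4) (by simp)).norm_rpow_div 2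
  have h42 : (4 : ENNReal) / 2 = 2 := by
    rw [show (4 : ENNReal) = 2 * 2 by norm_num, ENNReal.mul_div_cancel_right (by simp) (by simp)]
  simpa [h42] using h

lemma integrable_pow_four_of_hasGaussianLaw (hG : HasGaussianLaw G μ) :
    Integrable (fun ω => G ω ^ 4) μ := by
  simpa [← pow_mul] using (memLp_two_sq_of_hasGaussianLaw hG).integrable_sq

lemma integral_pow_four_of_hasGaussianLaw (hG : HasGaussianLaw G μ)
    (hG0 : ∫ ω, G ω ∂μ = 0) : ∫ ω, G ω ^ 4 ∂μ = 3 * Var[G; μ] ^ 2 := by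
  rw [← integral_map hG.aemeasurable (f := fun x : ℝ => x ^ 4) (by fun_prop),
    hG.map_eq_gaussianReal, hG0, integral_pow_four_gaussianReal,
    Real.coe_toNNReal _ (variance_nonneg _ _)]

lemma integral_sq_mul_sq_of_hasGaussianLaw (hGH : HasGaussianLaw (fun ω => (G ω, H ω)) μ)
    (hG0 : ∫ ω, G ω ∂μ = 0) (hH0 : ∫ ω, H ω ∂μ = 0) :
    ∫ ω, G ω ^ 2 * H ω ^ 2 ∂μ = Var[G; μ] * Var[H; μ] + 2 * cov[G, H; μ] ^ 2 := by
  have := hGH.isProbabilityMeasure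
  have hG := hGH.fst
  have hH := hGH.snd
  have hsq : Integrable (fun ω => G ω ^ 2 * H ω ^ 2) μ :=
    (memLp_two_sq_of_hasGaussianLaw hG).integrable_mul (memLp_two_sq_of_hasGaussianLaw hH)
  have hG4 := integrable_pow_four_of_hasGaussianLaw hG
  have hH4 := integrable_pow_four_of_hasGaussianLaw hH
  have hpolar : ∫ ω, (G ω + H ω) ^ 4 ∂μ + ∫ ω, (G ω - H ω) ^ 4 ∂μ =
      2 * ∫ ω, G ω ^ 4 ∂μ + 2 * ∫ ω, H ω ^ 4 ∂μ + 12 * ∫ ω, G ω ^ 2 * H ω ^ 2 ∂μ := by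
    rw [← integral_add (integrable_pow_four_of_hasGaussianLaw hGH.fun_add)
        (integrable_pow_four_of_hasGaussianLaw hGH.fun_sub), ← integral_const_mul,
      ← integral_const_mul, ← integral_const_mul,
      ← integral_add (hG4.const_mul 2) (hH4.const_mul 2),
      ← integral_add ((hG4.const_mul 2).fun_add (hH4.const_mul 2)) (hsq.const_mul 12)]
    congr with ω
    ring
  rw [integral_pow_four_of_hasGaussianLaw hGH.fun_add
      (by rw [integral_add hG.integrable hH.integrable, hG0, hH0, add_zero]),
    integral_pow_four_of_hasGaussianLaw hGH.fun_sub
      (by rw [integral_sub hG.integrable hH.integrable, hG0, hH0, sub_zero]),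
    integral_pow_four_of_hasGaussianLaw hG hG0, integral_pow_four_of_hasGaussianLaw hH hH0,
    variance_fun_add hG.memLp_two hH.memLp_two,
    variance_fun_sub hG.memLp_two hH.memLp_two] at hpolar
  linarith

lemma covariance_sq_sq_of_hasGaussianLaw (hGH : HasGaussianLaw (fun ω => (G ω, H ω)) μ)
    (hG0 : ∫ ω, G ω ∂μ = 0) (hH0 : ∫ ω, H ω ∂μ = 0) :
    cov[fun ω => G ω ^ 2, fun ω => H ω ^ 2; μ] = 2 * cov[G, H; μ] ^ 2 := by
  have := hGH.isProbabilityMeasure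
  rw [covariance_eq_sub (memLp_two_sq_of_hasGaussianLaw hGH.fst)
      (memLp_two_sq_of_hasGaussianLaw hGH.snd),
    ← variance_of_integral_eq_zero hGH.fst.aemeasurable hG0,
    ← variance_of_integral_eq_zero hGH.snd.aemeasurable hH0]
  simp only [Pi.mul_apply]
  rw [integral_sq_mul_sq_of_hasGaussianLaw hGH hG0 hH0]
  ring

end GaussianMoments

section ShortRange

/-- The kernel `K`, indexed by pairs of antennas, has constant diagonal `κ` and is bounded by a
multiple of the inverse lag `(1 + |m - n|)⁻¹`. Rows are then square summable, uniformly, which is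
what the laws of large numbers below require of covariances. -/
structure IsShortRange {E : Type*} [Norm E] (K : ℕ → ℕ → E) (κ : E) : Prop where
  diag : ∀ m, K m m = κ
  decay : ∃ C : ℝ, ∀ m n : ℕ, ‖K m n‖ * (1 + |(m : ℝ) - n|) ≤ C

lemma summable_inv_one_add_abs_sq : Summable fun k : ℤ => ((1 + |(k : ℝ)|) ^ 2)⁻¹ := by
  have hnat : Summable fun n : ℕ => ((1 + |((n : ℤ) : ℝ)|) ^ 2)⁻¹ :=
    ((summable_nat_add_iff 1).2 (Real.summable_nat_pow_inv.2 one_lt_two)).congr fun n => by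
      simp [add_comm]
  exact .of_nat_of_neg hnat (by simpa using hnat)

namespace IsShortRange

variable {E : Type*} [SeminormedAddCommGroup E] {K K' : ℕ → ℕ → E} {κ κ' : E}

lemma zero : IsShortRange (fun _ _ => (0 : E)) 0 := ⟨fun _ => rfl, 0, by simp⟩

lemma swap (hK : IsShortRange K κ) : IsShortRange (fun m n => K n m) κ := by
  obtain ⟨C, hC⟩ := hK.decay
  exact ⟨hK.diag, C, fun m n => by rw [abs_sub_comm]; exact hC n m⟩

lemma add (hK : IsShortRange K κ) (hK' : IsShortRange K' κ') :
    IsShortRange (fun m n => K m n + K' m n) (κ + κ') := by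
  obtain ⟨C, hC⟩ := hK.decay
  obtain ⟨C', hC'⟩ := hK'.decay
  refine ⟨fun m => by rw [hK.diag, hK'.diag], C + C', fun m n => ?_⟩
  calc ‖K m n + K' m n‖ * (1 + |(m : ℝ) - n|)
      ≤ (‖K m n‖ + ‖K' m n‖) * (1 + |(m : ℝ) - n|) := by gcongr; exact norm_add_le _ _
    _ ≤ C + C' := by rw [add_mul]; exact add_le_add (hC m n) (hC' m n)

lemma map {F : Type*} [SeminormedAddCommGroup F] [NormedSpace ℝ E] [NormedSpace ℝ F]
    (hK : IsShortRange K κ) (A : E →L[ℝ] F) :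
    IsShortRange (fun m n => A (K m n)) (A κ) := by
  obtain ⟨C, hC⟩ := hK.decay
  refine ⟨fun m => by rw [hK.diag], ‖A‖ * C, fun m n => ?_⟩
  calc ‖A (K m n)‖ * (1 + |(m : ℝ) - n|)
      ≤ ‖A‖ * ‖K m n‖ * (1 + |(m : ℝ) - n|) := by gcongr; exact A.le_opNorm _
    _ ≤ ‖A‖ * C := by rw [mul_assoc]; gcongr; exact hC m n

lemma exists_sum_norm_sq_le (hK : IsShortRange K κ) :
    ∃ B : ℝ, ∀ m n : ℕ, ∑ k ∈ Finset.range n, ‖K m k‖ ^ 2 ≤ B := by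
  obtain ⟨C, hC⟩ := hK.decay
  refine ⟨C ^ 2 * ∑' k : ℤ, ((1 + |(k : ℝ)|) ^ 2)⁻¹, fun m n => ?_⟩
  have hinj : Function.Injective fun k : ℕ => (m : ℤ) - k := fun a b h => by simpa using h
  have hterm (k : ℕ) : ‖K m k‖ ^ 2 ≤ C ^ 2 * ((1 + |(((m : ℤ) - k : ℤ) : ℝ)|) ^ 2)⁻¹ := by
    push_cast
    rw [← div_eq_mul_inv, le_div_iff₀ (by positivity), ← mul_pow]
    have := hC m k
    gcongr
  calc ∑ k ∈ Finset.range n, ‖K m k‖ ^ 2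
      ≤ C ^ 2 * ∑ k ∈ Finset.range n, ((1 + |(((m : ℤ) - k : ℤ) : ℝ)|) ^ 2)⁻¹ := by
        rw [Finset.mul_sum]
        exact Finset.sum_le_sum fun k _ => hterm k
    _ ≤ C ^ 2 * ∑' k : ℤ, ((1 + |(k : ℝ)|) ^ 2)⁻¹ := by
        rw [← Finset.sum_image (f := fun k : ℤ => ((1 + |(k : ℝ)|) ^ 2)⁻¹) hinj.injOn]
        gcongr
        exact summable_inv_one_add_abs_sq.sum_le_tsum _ fun _ _ => by positivity

end IsShortRange

end ShortRange

section LawOfLargeNumbers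

variable {Ω : Type*} [MeasurableSpace Ω] {μ : Measure Ω} [IsProbabilityMeasure μ]

lemma ae_tendsto_of_summable_variance {X : ℕ → Ω → ℝ} (hX : ∀ n, MemLp (X n) 2 μ) {s : ℝ}
    (hs : ∀ n, ∫ ω, X n ω ∂μ = s) (hvar : Summable fun n => Var[X n; μ]) :
    ∀ᵐ ω ∂μ, Tendsto (fun n => X n ω) atTop (𝓝 s) := by
  have hmeas (n : ℕ) : AEMeasurable (fun ω => ENNReal.ofReal ((X n ω - s) ^ 2)) μ := by
    have := (hX n).aemeasurable
    fun_prop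
  have hfin : ∫⁻ ω, ∑' n, ENNReal.ofReal ((X n ω - s) ^ 2) ∂μ ≠ ⊤ := by
    rw [lintegral_tsum hmeas]
    convert hvar.tsum_ofReal_ne_top with n
    rw [ofReal_variance (hX n), evariance_eq_lintegral_ofReal, hs]
  filter_upwards [ae_lt_top' (by fun_prop) hfin] with ω hω
  have hsq : Tendsto (fun n => (X n ω - s) ^ 2) atTop (𝓝 0) := by
    simpa [ENNReal.toReal_ofReal, sq_nonneg] using
      (ENNReal.summable_toReal hω.ne).tendsto_atTop_zero
  have habs := hsq.sqrt
  simp only [Real.sqrt_sq_eq_abs, Real.sqrt_zero] at habs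
  exact tendsto_sub_nhds_zero_iff.1 ((tendsto_zero_iff_abs_tendsto_zero _).2 habs)

lemma summable_inv_floor_pow {c : ℝ} (hc : 1 < c) :
    Summable fun n : ℕ => ((⌊c ^ n⌋₊ : ℝ))⁻¹ := by
  have hc' : 0 < 1 - c⁻¹ := sub_pos.2 (inv_lt_one_of_one_lt₀ hc)
  refine Summable.of_nonneg_of_le (fun n => by positivity) (fun n => ?_)
    ((summable_geometric_of_lt_one (by positivity) (inv_lt_one_of_one_lt₀ hc)).mul_left
      (1 - c⁻¹)⁻¹)
  rw [inv_pow, ← mul_inv]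
  exact inv_anti₀ (by positivity) (mul_pow_le_nat_floor_pow hc n)

/-- The partial sums are monotone, so it is enough that the averages converge along `⌊c ^ n⌋` for
`c` close to `1`; there the variances are summable. -/
theorem ae_tendsto_average_of_variance_sum_le {Y : ℕ → Ω → ℝ} (hY : ∀ n, MemLp (Y n) 2 μ)
    (hnonneg : ∀ n ω, 0 ≤ Y n ω) {s B : ℝ} (hs : ∀ n, ∫ ω, Y n ω ∂μ = s)
    (hB : ∀ n : ℕ, Var[fun ω => ∑ i ∈ Finset.range n, Y i ω; μ] ≤ B * n) :
    ∀ᵐ ω ∂μ, Tendsto (fun n : ℕ => (∑ i ∈ Finset.range n, Y i ω) / n) atTop (𝓝 s) := by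
  have hfloor {c : ℝ} (hc : 1 < c) : ∀ᵐ ω ∂μ, Tendsto
      (fun n : ℕ => (∑ i ∈ Finset.range ⌊c ^ n⌋₊, Y i ω) / ⌊c ^ n⌋₊) atTop (𝓝 s) := by
    have hpos (n : ℕ) : (0 : ℝ) < ⌊c ^ n⌋₊ :=
      Nat.cast_pos.2 (Nat.floor_pos.2 (one_le_pow₀ hc.le))
    simp_rw [div_eq_inv_mul]
    refine ae_tendsto_of_summable_variance
      (fun n => (memLp_finsetSum _ fun i _ => hY i).const_mul _) (fun n => ?_) ?_
    · rw [integral_const_mul, integral_finsetSum _ fun i _ => (hY i).integrable one_le_two]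
      simp only [hs, Finset.sum_const, Finset.card_range, nsmul_eq_mul]
      rw [inv_mul_cancel_left₀ (hpos n).ne']
    · refine .of_nonneg_of_le (fun n => variance_nonneg _ _) (fun n => ?_)
        ((summable_inv_floor_pow hc).mul_left B)
      calc Var[fun ω => (⌊c ^ n⌋₊ : ℝ)⁻¹ * ∑ i ∈ Finset.range ⌊c ^ n⌋₊, Y i ω; μ]
          ≤ (⌊c ^ n⌋₊ : ℝ)⁻¹ ^ 2 * (B * ⌊c ^ n⌋₊) := by
            rw [variance_const_mul]
            gcongr
            exact hB _
        _ = B * (⌊c ^ n⌋₊ : ℝ)⁻¹ := by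
            have := (hpos n).ne'
            field_simp
  have hall : ∀ᵐ ω ∂μ, ∀ k : ℕ, Tendsto (fun n : ℕ =>
      (∑ i ∈ Finset.range ⌊(1 + 1 / ((k : ℝ) + 1)) ^ n⌋₊, Y i ω) /
        ⌊(1 + 1 / ((k : ℝ) + 1)) ^ n⌋₊) atTop (𝓝 s) :=
    ae_all_iff.2 fun k => hfloor (lt_add_of_pos_right 1 (by positivity))
  filter_upwards [hall] with ω hω
  refine tendsto_div_of_monotone_of_tendsto_div_floor_pow
    (fun n => ∑ i ∈ Finset.range n, Y i ω) s ?_ (fun k : ℕ => 1 + 1 / ((k : ℝ) + 1))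
    (fun k => lt_add_of_pos_right 1 (by positivity)) ?_ hω
  · exact fun m n hmn => Finset.sum_le_sum_of_subset_of_nonneg (by simpa using hmn)
      fun i _ _ => hnonneg i ω
  · simpa using tendsto_one_div_add_atTop_nhds_zero_nat.const_add (1 : ℝ)

lemma ae_tendsto_average_sq {G : ℕ → Ω → ℝ} (hG : IsGaussianProcess G μ)
    (hG0 : ∀ m, ∫ ω, G m ω ∂μ = 0) {s : ℝ}
    (hcov : IsShortRange (fun m n => cov[G m, G n; μ]) s) :
    ∀ᵐ ω ∂μ, Tendsto (fun n : ℕ => (∑ i ∈ Finset.range n, G i ω ^ 2) / n) atTop (𝓝 s) := by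
  obtain ⟨B, hB⟩ := hcov.exists_sum_norm_sq_le
  have hL2 (m : ℕ) := memLp_two_sq_of_hasGaussianLaw (hG.hasGaussianLaw_eval m)
  refine ae_tendsto_average_of_variance_sum_le hL2 (fun m ω => sq_nonneg _) (B := 2 * B)
    (fun m => ?_) fun n => ?_
  · rw [← variance_of_integral_eq_zero (hG.aemeasurable m) (hG0 m),
      ← covariance_self (hG.aemeasurable m), hcov.diag]
  calc Var[fun ω => ∑ i ∈ Finset.range n, G i ω ^ 2; μ]
      = ∑ i ∈ Finset.range n, 2 * ∑ j ∈ Finset.range n, ‖cov[G i, G j; μ]‖ ^ 2 := by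
        rw [variance_fun_sum' fun i _ => hL2 i]
        simp_rw [Finset.mul_sum, Real.norm_eq_abs, sq_abs]
        exact Finset.sum_congr rfl fun i _ => Finset.sum_congr rfl fun j _ =>
          covariance_sq_sq_of_hasGaussianLaw hG.hasGaussianLaw_prodMk (hG0 i) (hG0 j)
    _ ≤ ∑ i ∈ Finset.range n, 2 * B := by
        gcongr with i
        exact hB i n
    _ = 2 * B * n := by
        rw [Finset.sum_const, Finset.card_range, nsmul_eq_mul, mul_comm]

variable {T : Type*} {X : T → Ω → ℝ} {p q : ℕ → T} {a b c : ℝ}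

lemma ae_tendsto_average_add_sq (hX : IsGaussianProcess X μ) (hX0 : ∀ t, ∫ ω, X t ω ∂μ = 0)
    (hpp : IsShortRange (fun m n => cov[X (p m), X (p n); μ]) a)
    (hqq : IsShortRange (fun m n => cov[X (q m), X (q n); μ]) b)
    (hpq : IsShortRange (fun m n => cov[X (p m), X (q n); μ]) c) :
    ∀ᵐ ω ∂μ, Tendsto (fun n : ℕ => (∑ i ∈ Finset.range n, (X (p i) ω + X (q i) ω) ^ 2) / n)
      atTop (𝓝 (a + c + (c + b))) := by
  classical
  have hL2 (t : T) : MemLp (X t) 2 μ := (hX.hasGaussianLaw_eval t).memLp_two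
  refine ae_tendsto_average_sq (G := fun m => X (p m) + X (q m)) ?_ (fun m => ?_) ?_
  · exact hX.of_isGaussianProcess fun m => ⟨{p m, q m},
      .proj ⟨p m, by simp⟩ + .proj ⟨q m, by simp⟩, fun ω => by simp⟩
  · simp only [Pi.add_apply]
    rw [integral_add ((hL2 _).integrable one_le_two) ((hL2 _).integrable one_le_two), hX0, hX0,
      add_zero]
  · simp_rw [covariance_add_left (hL2 _) (hL2 _) ((hL2 _).add (hL2 _)),
      covariance_add_right (hL2 _) (hL2 _) (hL2 _)]
    refine (hpp.add hpq).add (.add ?_ hqq)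
    simpa only [covariance_comm] using hpq.swap

lemma ae_tendsto_average_mul (hX : IsGaussianProcess X μ) (hX0 : ∀ t, ∫ ω, X t ω ∂μ = 0)
    (hpp : IsShortRange (fun m n => cov[X (p m), X (p n); μ]) a)
    (hqq : IsShortRange (fun m n => cov[X (q m), X (q n); μ]) b)
    (hpq : IsShortRange (fun m n => cov[X (p m), X (q n); μ]) c) :
    ∀ᵐ ω ∂μ, Tendsto (fun n : ℕ => (∑ i ∈ Finset.range n, X (p i) ω * X (q i) ω) / n)
      atTop (𝓝 c) := by
  filter_upwards [ae_tendsto_average_add_sq hX hX0 hpp hqq hpq,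
    ae_tendsto_average_sq (hX.comp_right p) (fun m => hX0 (p m)) hpp,
    ae_tendsto_average_sq (hX.comp_right q) (fun m => hX0 (q m)) hqq] with ω hsum hp hq
  have h := ((hsum.sub hp).sub hq).div_const 2
  rw [show (a + c + (c + b) - a - b) / 2 = c by ring] at h
  refine h.congr fun n => ?_
  simp_rw [add_sq, Finset.sum_add_distrib, mul_assoc, ← Finset.mul_sum, Function.comp_apply]
  ring

end LawOfLargeNumbers

section ComplexGaussian

variable {Ω T : Type*} [MeasurableSpace Ω] {μ : Measure Ω}

/-- Empirical cross-correlation of the first `n` terms of two complex sequences, conjugate-linear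
in the first one; it is `0` for `n = 0`. -/
def empiricalCorr (y z : ℕ → ℂ) (n : ℕ) : ℂ :=
  (∑ i ∈ Finset.range n, star (y i) * z i) / n

lemma star_mul_eq_re_mul_re (y z : ℂ) :
    star y * z = (((1 * z).re * (1 * y).re + (-Complex.I * z).re * (-Complex.I * y).re : ℝ) : ℂ) +
      Complex.I *
        ((-Complex.I * z).re * (1 * y).re - (1 * z).re * (-Complex.I * y).re : ℝ) := by
  apply Complex.ext <;> simp <;> ring

namespace IsCircularGaussian

variable {X : T → Ω → ℂ} {K : T → T → ℂ}

lemma memLp_two (hX : IsCircularGaussian X K μ) (t : T) : MemLp (X t) 2 μ :=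
  (hX.gaussian.hasGaussianLaw_eval t).memLp_two

lemma integral_re_mul (hX : IsCircularGaussian X K μ) (ε : ℂ) (t : T) :
    ∫ ω, (ε * X t ω).re ∂μ = 0 := by
  have h := integral_re ((hX.gaussian.hasGaussianLaw_eval t).integrable.const_mul ε)
  rwa [integral_const_mul, hX.mean, mul_zero, map_zero] at h

lemma covariance_re_mul_re_mul (hX : IsCircularGaussian X K μ) (ε δ : ℂ) (s t : T) :
    cov[fun ω => (ε * X s ω).re, fun ω => (δ * X t ω).re; μ] = (ε * star δ * K s t).re / 2 := by
  have := hX.gaussian.isProbabilityMeasure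
  have hint : Integrable (fun ω => X s ω * X t ω) μ :=
    (hX.memLp_two s).integrable_mul (hX.memLp_two t)
  have hint_star : Integrable (fun ω => X s ω * star (X t ω)) μ :=
    (hX.memLp_two s).integrable_mul (hX.memLp_two t).star
  have hmul (ω : Ω) : (ε * X s ω).re * (δ * X t ω).re =
      (ε * star δ / 2 * (X s ω * star (X t ω)) + ε * δ / 2 * (X s ω * X t ω)).re := by
    simp
    ring
  have hre (η : ℂ) (t : T) : MemLp (fun ω => (η * X t ω).re) 2 μ :=
    ((hX.memLp_two t).const_mul η).re
  have hsum := integral_re ((hint_star.const_mul (ε * star δ / 2)).fun_add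
    (hint.const_mul (ε * δ / 2)))
  rw [covariance_eq_sub (hre ε s) (hre δ t), hX.integral_re_mul, zero_mul, sub_zero]
  simp only [Pi.mul_apply, hmul]
  refine hsum.trans ?_
  rw [integral_add (hint_star.const_mul _) (hint.const_mul _), integral_const_mul,
    integral_const_mul, hX.covariance, hX.pseudoCovariance]
  simp [div_mul_eq_mul_div]

lemma isGaussianProcess_re_mul (hX : IsCircularGaussian X K μ) :
    IsGaussianProcess (fun (i : T × ℂ) ω => (i.2 * X i.1 ω).re) μ :=
  (hX.gaussian.comp_right Prod.fst).comp_left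
    fun i => Complex.reCLM ∘L ContinuousLinearMap.mul ℝ ℂ i.2

lemma isShortRange_covariance_re_mul (hX : IsCircularGaussian X K μ) {p q : ℕ → T} {k : ℂ}
    (h : IsShortRange (fun m n => K (p m) (q n)) k) (ε δ : ℂ) :
    IsShortRange
      (fun m n => cov[fun ω => (ε * X (p m) ω).re, fun ω => (δ * X (q n) ω).re; μ])
      ((ε * star δ * k).re / 2) := by
  simp_rw [hX.covariance_re_mul_re_mul]
  simpa [div_eq_inv_mul] using
    h.map ((2⁻¹ : ℝ) • Complex.reCLM ∘L ContinuousLinearMap.mul ℝ ℂ (ε * star δ))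

variable {p q : ℕ → T} {a b c : ℂ}

lemma ae_tendsto_average_re_mul_re (hX : IsCircularGaussian X K μ)
    (hpp : IsShortRange (fun m n => K (p m) (p n)) a)
    (hqq : IsShortRange (fun m n => K (q m) (q n)) b)
    (hpq : IsShortRange (fun m n => K (p m) (q n)) c) (ε δ : ℂ) :
    ∀ᵐ ω ∂μ, Tendsto
      (fun n : ℕ => (∑ i ∈ Finset.range n, (ε * X (p i) ω).re * (δ * X (q i) ω).re) / n) atTop
      (𝓝 ((ε * star δ * c).re / 2)) := by
  have := hX.gaussian.isProbabilityMeasure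
  exact ae_tendsto_average_mul (X := fun (i : T × ℂ) ω => (i.2 * X i.1 ω).re)
    (p := fun i => (p i, ε)) (q := fun i => (q i, δ))
    hX.isGaussianProcess_re_mul (fun i => hX.integral_re_mul i.2 i.1)
    (hX.isShortRange_covariance_re_mul hpp ε ε) (hX.isShortRange_covariance_re_mul hqq δ δ)
    (hX.isShortRange_covariance_re_mul hpq ε δ)

theorem ae_tendsto_empiricalCorr (hX : IsCircularGaussian X K μ)
    (hpp : IsShortRange (fun m n => K (p m) (p n)) a)
    (hqq : IsShortRange (fun m n => K (q m) (q n)) b)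
    (hqp : IsShortRange (fun m n => K (q m) (p n)) c) :
    ∀ᵐ ω ∂μ, Tendsto (empiricalCorr (fun i => X (p i) ω) fun i => X (q i) ω) atTop (𝓝 c) := by
  have hre := hX.ae_tendsto_average_re_mul_re hqq hpp hqp
  filter_upwards [hre 1 1, hre 1 (-Complex.I), hre (-Complex.I) 1, hre (-Complex.I) (-Complex.I)]
    with ω h11 h1I hI1 hII
  have h := ((Complex.continuous_ofReal.tendsto _).comp (h11.add hII)).add
    (((Complex.continuous_ofReal.tendsto _).comp (hI1.sub h1I)).const_mul Complex.I)
  convert h using 2 with n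
  · simp_rw [empiricalCorr, star_mul_eq_re_mul_re, Finset.sum_add_distrib, ← Finset.mul_sum,
      ← Complex.ofReal_sum, Finset.sum_add_distrib, Finset.sum_sub_distrib]
    simp only [Function.comp_apply]
    push_cast
    ring
  · exact Complex.ext (by simp) (by simp; ring)

end IsCircularGaussian

lemma isGaussianProcess_sumElim {S E : Type*} [NormedAddCommGroup E] [NormedSpace ℝ E]
    [MeasurableSpace E] [BorelSpace E] [SecondCountableTopology E] [CompleteSpace E]
    {X : S → Ω → E} {Y : T → Ω → E}
    (hX : IsGaussianProcess X μ) (hY : IsGaussianProcess Y μ)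
    (hXY : IndepFun (fun ω s => X s ω) (fun ω t => Y t ω) μ) :
    IsGaussianProcess (Sum.elim X Y) μ where
  hasGaussianLaw I := by
    have hind : IndepFun (fun ω => I.toLeft.restrict (X · ω))
        (fun ω => I.toRight.restrict (Y · ω)) μ :=
      hXY.comp (Finset.measurable_restrict _) (Finset.measurable_restrict _)
    have h := hind.hasGaussianLaw (hX.hasGaussianLaw I.toLeft) (hY.hasGaussianLaw I.toRight)
    let A : ((I.toLeft → E) × (I.toRight → E)) →L[ℝ] (I → E) :=
      ContinuousLinearMap.pi fun i => match i with
        | ⟨.inl s, hs⟩ => .proj ⟨s, by simpa using hs⟩ ∘L .fst ℝ _ _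
        | ⟨.inr t, ht⟩ => .proj ⟨t, by simpa using ht⟩ ∘L .snd ℝ _ _
    have hA : (fun ω => I.restrict (Sum.elim X Y · ω)) =
        A ∘ fun ω => (I.toLeft.restrict (X · ω), I.toRight.restrict (Y · ω)) := by
      funext ω i
      obtain ⟨s | t, hi⟩ := i <;> rfl
    rw [hA]
    exact h.map A

/-- Covariance kernel of the union of two independent centred families. -/
def blockCov {S : Type*} (K : S → S → ℂ) (K' : T → T → ℂ) : S ⊕ T → S ⊕ T → ℂ
  | .inl s, .inl s' => K s s'
  | .inr t, .inr t' => K' t t'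
  | _, _ => 0

lemma IsCircularGaussian.sumElim {S : Type*} {X : S → Ω → ℂ} {Y : T → Ω → ℂ}
    {K : S → S → ℂ} {K' : T → T → ℂ} (hX : IsCircularGaussian X K μ)
    (hY : IsCircularGaussian Y K' μ)
    (hXY : IndepFun (fun ω s => X s ω) (fun ω t => Y t ω) μ) :
    IsCircularGaussian (Sum.elim X Y) (blockCov K K') μ := by
  have hcross {f : ℂ → ℂ} (hf : Measurable f) (s : S) (t : T) :
      ∫ ω, X s ω * f (Y t ω) ∂μ = 0 := by
    have hind : IndepFun (X s) (fun ω => f (Y t ω)) μ :=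
      hXY.comp (measurable_pi_apply s) (hf.comp (measurable_pi_apply t))
    rw [hind.integral_fun_mul_eq_mul_integral (hX.measurable s).aestronglyMeasurable
      (hf.comp (hY.measurable t)).aestronglyMeasurable, hX.mean, zero_mul]
  refine ⟨?_, isGaussianProcess_sumElim hX.gaussian hY.gaussian hXY, ?_, ?_, ?_⟩
  · rintro (s | t)
    exacts [hX.measurable s, hY.measurable t]
  · rintro (s | t)
    exacts [hX.mean s, hY.mean t]
  · rintro (s | t) (s' | t')
    · exact hX.covariance s s'
    · exact hcross continuous_star.measurable s t'
    · have h := congrArg star (hcross continuous_star.measurable s' t)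
      rw [Complex.star_def, ← integral_conj] at h
      simpa [blockCov, mul_comm] using h
    · exact hY.covariance t t'
  · rintro (s | t) (s' | t')
    · exact hX.pseudoCovariance s s'
    · exact hcross measurable_id s t'
    · simpa [mul_comm] using hcross measurable_id s' t
    · exact hY.pseudoCovariance t t'

end ComplexGaussian

section OneRing

lemma norm_exp_neg_I_mul (x y : ℝ) : ‖Complex.exp (-(Complex.I * x * y))‖ = 1 := by
  rw [← Complex.norm_exp_ofReal_mul_I (-(x * y))]
  congr 2
  push_cast
  ring

/-- The van der Corput estimate for a phase without critical points: integrate by parts with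
`exp (-i c f) = (1 / f') * (f' exp (-i c f))`. -/
lemma exists_norm_integral_exp_mul_le {f f' f'' : ℝ → ℝ} {a b : ℝ}
    (hf : ∀ x ∈ Set.uIcc a b, HasDerivAt f (f' x) x)
    (hf' : ∀ x ∈ Set.uIcc a b, HasDerivAt f' (f'' x) x)
    (hf'' : ContinuousOn f'' (Set.uIcc a b)) (hne : ∀ x ∈ Set.uIcc a b, f' x ≠ 0) :
    ∃ C : ℝ, ∀ c : ℝ, ‖∫ x in a..b, Complex.exp (-(Complex.I * c * f x))‖ * (1 + |c|) ≤ C := by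
  let u (x : ℝ) : ℂ := ((f' x)⁻¹ : ℝ)
  let u' (x : ℝ) : ℂ := (-f'' x / f' x ^ 2 : ℝ)
  refine ⟨|b - a| + (‖u b‖ + ‖u a‖ + |∫ x in a..b, ‖u' x‖|), fun c => ?_⟩
  let v (x : ℝ) : ℂ := Complex.exp (-(Complex.I * c * f x))
  have hv (x : ℝ) : ‖v x‖ = 1 := norm_exp_neg_I_mul c (f x)
  have hfc : ContinuousOn f (Set.uIcc a b) := HasDerivAt.continuousOn hf
  have hfc' : ContinuousOn f' (Set.uIcc a b) := HasDerivAt.continuousOn hf'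
  have hparts := intervalIntegral.integral_mul_deriv_eq_deriv_mul (u := u) (u' := u') (v := v)
    (v' := fun x => v x * -(Complex.I * c * f' x)) (a := a) (b := b)
    (fun x hx => ((hf' x hx).inv (hne x hx)).ofReal_comp)
    (fun x hx => (((hf x hx).ofReal_comp).const_mul (Complex.I * c)).neg.cexp)
    (Complex.continuous_ofReal.comp_continuousOn
      (hf''.neg.div (hfc'.pow 2) fun x hx => pow_ne_zero 2 (hne x hx))).intervalIntegrable
    (ContinuousOn.intervalIntegrable (by fun_prop))
  have hphase : ∫ x in a..b, u x * (v x * -(Complex.I * c * f' x)) =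
      -(Complex.I * c) * ∫ x in a..b, v x := by
    rw [← intervalIntegral.integral_const_mul]
    refine intervalIntegral.integral_congr fun x hx => ?_
    have : (f' x : ℂ) ≠ 0 := by exact_mod_cast hne x hx
    simp only [u, Complex.ofReal_inv]
    field_simp
  have hbound : ‖∫ x in a..b, v x‖ ≤ |b - a| := by
    simpa using intervalIntegral.norm_integral_le_of_norm_le_const fun x _ => (hv x).le
  rw [mul_one_add]
  refine add_le_add hbound ?_
  calc ‖∫ x in a..b, v x‖ * |c| = ‖u b * v b - u a * v a - ∫ x in a..b, u' x * v x‖ := by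
        rw [← hparts, hphase]
        simp [mul_comm]
    _ ≤ ‖u b * v b‖ + ‖u a * v a‖ + ‖∫ x in a..b, u' x * v x‖ :=
        (norm_sub_le _ _).trans (add_le_add_left (norm_sub_le _ _) _)
    _ ≤ ‖u b‖ + ‖u a‖ + |∫ x in a..b, ‖u' x‖| := by
        simpa [hv] using
          intervalIntegral.norm_integral_le_abs_integral_norm (f := fun x => u' x * v x)

lemma oneRing_self (D θ : ℝ) {Δ : ℝ} (hΔ : Δ ≠ 0) (L m : ℕ) :
    oneRing D Δ θ L m m = 1 / (L : ℂ) := by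
  have : (Δ : ℂ) ≠ 0 := by exact_mod_cast hΔ
  simp only [oneRing, sub_self, mul_zero, zero_mul, neg_zero, Complex.exp_zero,
    intervalIntegral.integral_const, Complex.real_smul]
  push_cast
  rw [show ((Δ : ℂ) + θ - (-Δ + θ)) * 1 = 2 * Δ by ring, div_mul_eq_mul_div, one_mul,
    div_mul_cancel_left₀ (by simpa), one_div]

lemma isShortRange_oneRing {D Δ θ : ℝ} (hD : D ≠ 0) (hΔ : 0 < Δ)
    (hcos : ∀ α ∈ Set.Icc (θ - Δ) (θ + Δ), Real.cos α ≠ 0) (L : ℕ) :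
    IsShortRange (oneRing D Δ θ L) (1 / L) := by
  obtain ⟨C, hC⟩ := exists_norm_integral_exp_mul_le (a := -Δ + θ) (b := Δ + θ)
    (fun x _ => (Real.hasDerivAt_sin x).const_mul (2 * Real.pi * D))
    (fun x _ => (Real.hasDerivAt_cos x).const_mul (2 * Real.pi * D)) (by fun_prop)
    (fun x hx => mul_ne_zero (by positivity) (hcos x (by
      rwa [Set.uIcc_of_le (by linarith), neg_add_eq_sub, add_comm Δ] at hx)))
  refine ⟨oneRing_self D θ hΔ.ne' L, ‖(1 / (2 * Δ * L) : ℂ)‖ * C, fun m n => ?_⟩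
  rw [oneRing, norm_mul, mul_assoc]
  gcongr
  refine Eq.trans_le ?_ (hC (m - n))
  congr! 6 with α
  push_cast
  ring

end OneRing

section Dft

variable {N L : ℕ}

lemma sqrt_natCast_ne_zero_of_fin (j : Fin N) : (Real.sqrt N : ℂ) ≠ 0 := by
  exact_mod_cast (Real.sqrt_pos.2 (Nat.cast_pos.2 j.pos)).ne'

/-- The primitive `N`-th root of unity whose powers are, up to conjugation, the entries of the
DFT matrix. -/
def dftRoot (N : ℕ) : ℂ := Complex.exp (2 * Real.pi * Complex.I / N)

lemma dftL_apply (hLN : L ≤ N) (j : Fin N) (l : Fin L) :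
    dftL hLN j l = Complex.exp (-(2 * Real.pi * Complex.I * (j : ℕ) * (l : ℕ) / N)) :=
  mul_div_cancel₀ _ (sqrt_natCast_ne_zero_of_fin j)

lemma dft_eq_dftL_div (j t : Fin N) : dft N j t = dftL le_rfl j t / (Real.sqrt N : ℂ) :=
  (mul_div_cancel_left₀ _ (sqrt_natCast_ne_zero_of_fin j)).symm

lemma star_dftL_mul_dftL (hLN : L ≤ N) (j k : Fin N) (l : Fin L) :
    star (dftL hLN j l) * dftL hLN k l =
      (dftRoot N ^ ((j : ℤ) - k)) ^ (l : ℕ) := by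
  rw [dftL_apply, dftL_apply, Complex.star_def, ← Complex.exp_conj, ← Complex.exp_add,
    dftRoot, ← Complex.exp_int_mul, ← Complex.exp_nat_mul]
  congr 1
  simp only [map_neg, map_div₀, map_mul, Complex.conj_ofReal, Complex.conj_I, map_natCast,
    map_ofNat]
  push_cast
  ring

lemma dftRoot_zpow_eq_one_iff (j : Fin N) (k : ℤ) :
    dftRoot N ^ k = 1 ↔ (N : ℤ) ∣ k :=
  (Complex.isPrimitiveRoot_exp N j.pos.ne').zpow_eq_one_iff_dvd k

lemma dftRoot_zpow_sub_ne_one {j k : Fin N} (hjk : j ≠ k) :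
    dftRoot N ^ ((j : ℤ) - k) ≠ 1 := by
  rw [Ne, dftRoot_zpow_eq_one_iff j]
  intro h
  have := Int.eq_zero_of_abs_lt_dvd h (by rw [abs_lt]; omega)
  omega

lemma sum_star_dftL_mul_self (hLN : L ≤ N) (j : Fin N) :
    ∑ l, star (dftL hLN j l) * dftL hLN j l = L := by
  simp only [star_dftL_mul_dftL, sub_self, zpow_zero, one_pow, Finset.sum_const,
    Finset.card_univ, Fintype.card_fin, nsmul_eq_mul, mul_one]

lemma sum_star_dftL_mul_of_ne (hLN : L ≤ N) {j k : Fin N} (hjk : j ≠ k) :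
    ∑ l, star (dftL hLN j l) * dftL hLN k l =
      (dftRoot N ^ ((L : ℤ) * ((j : ℤ) - k)) - 1) /
        (dftRoot N ^ ((j : ℤ) - k) - 1) := by
  simp_rw [star_dftL_mul_dftL]
  rw [Fin.sum_univ_eq_sum_range (fun l =>
    (dftRoot N ^ ((j : ℤ) - k)) ^ l),
    geom_sum_eq (dftRoot_zpow_sub_ne_one hjk), mul_comm (L : ℤ), zpow_mul, zpow_natCast]

lemma sum_star_dftL_mul_ne_zero (hLN : L ≤ N) {j k : Fin N} (hjk : j ≠ k)
    (h : ¬ (N : ℤ) ∣ (L : ℤ) * ((j : ℤ) - k)) :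
    ∑ l, star (dftL hLN j l) * dftL hLN k l ≠ 0 := by
  rw [sum_star_dftL_mul_of_ne hLN hjk]
  exact div_ne_zero (sub_ne_zero.2 (mt (dftRoot_zpow_eq_one_iff j _).1 h))
    (sub_ne_zero.2 (dftRoot_zpow_sub_ne_one hjk))

lemma sum_star_dft_mul (j k : Fin N) :
    ∑ t, star (dft N j t) * dft N k t = if j = k then 1 else 0 := by
  have hN : (N : ℂ) ≠ 0 := by exact_mod_cast j.pos.ne'
  have hsqrt : (Real.sqrt N : ℂ) * Real.sqrt N = N := by
    rw [← Complex.ofReal_mul, Real.mul_self_sqrt (Nat.cast_nonneg N), Complex.ofReal_natCast]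
  simp_rw [dft_eq_dftL_div, star_div₀, Complex.star_def, Complex.conj_ofReal, div_mul_div_comm,
    hsqrt, ← Finset.sum_div, ← Complex.star_def]
  split_ifs with h
  · rw [h, sum_star_dftL_mul_self, div_self hN]
  · rw [sum_star_dftL_mul_of_ne _ h, (dftRoot_zpow_eq_one_iff j _).2 (dvd_mul_right _ _), sub_self,
      zero_div, zero_div]

end Dft

section NormalizedInner

lemma empiricalCorr_eq_inner (y z : ℕ → ℂ) (n : ℕ) :
    empiricalCorr y z n =
      inner ℂ (WithLp.toLp 2 fun i : Fin n => y i) (WithLp.toLp 2 fun i : Fin n => z i) / n := by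
  simp only [empiricalCorr, Finset.sum_range, PiLp.inner_apply, RCLike.inner_apply',
    Complex.star_def]

lemma sqrt_re_empiricalCorr_self (y : ℕ → ℂ) (n : ℕ) :
    Real.sqrt (empiricalCorr y y n).re =
      ‖(WithLp.toLp 2 fun i : Fin n => y i : EuclideanSpace ℂ (Fin n))‖ / Real.sqrt n := by
  rw [empiricalCorr_eq_inner, Complex.div_natCast_re, ← RCLike.re_eq_complex_re,
    inner_self_eq_norm_sq, Real.sqrt_div' _ (Nat.cast_nonneg n), Real.sqrt_sq (norm_nonneg _)]

lemma normalizedInner_eq_empiricalCorr_div (y z : ℕ → ℂ) (n : ℕ) :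
    normalizedInner y z n = empiricalCorr y z n /
      (Real.sqrt (empiricalCorr y y n).re * Real.sqrt (empiricalCorr z z n).re : ℝ) := by
  rcases eq_or_ne n 0 with rfl | hn
  · simp [normalizedInner, empiricalCorr, PiLp.inner_apply]
  have hn' : (n : ℂ) ≠ 0 := by exact_mod_cast hn
  rw [sqrt_re_empiricalCorr_self, sqrt_re_empiricalCorr_self, div_mul_div_comm,
    Real.mul_self_sqrt (Nat.cast_nonneg n), empiricalCorr_eq_inner, Complex.ofReal_div,
    Complex.ofReal_natCast, div_div_div_cancel_right₀ hn']
  simp only [normalizedInner, inner_smul_left, inner_smul_right, map_inv₀, Complex.conj_ofReal]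
  push_cast
  rw [div_eq_mul_inv, mul_inv]
  ring

lemma tendsto_normalizedInner {y z : ℕ → ℂ} {g a b : ℂ}
    (hyz : Tendsto (empiricalCorr y z) atTop (𝓝 g))
    (hyy : Tendsto (empiricalCorr y y) atTop (𝓝 a))
    (hzz : Tendsto (empiricalCorr z z) atTop (𝓝 b)) (ha : 0 < a.re) (hb : 0 < b.re) :
    Tendsto (normalizedInner y z) atTop
      (𝓝 (g / (Real.sqrt a.re * Real.sqrt b.re : ℝ))) := by
  have hsqrt {w : ℕ → ℂ} {c : ℂ} (h : Tendsto (empiricalCorr w w) atTop (𝓝 c)) :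
      Tendsto (fun n => Real.sqrt (empiricalCorr w w n).re) atTop (𝓝 (Real.sqrt c.re)) :=
    ((Complex.continuous_re.tendsto _).comp h).sqrt
  rw [funext (normalizedInner_eq_empiricalCorr_div y z)]
  refine hyz.div ((Complex.continuous_ofReal.tendsto _).comp ((hsqrt hyy).mul (hsqrt hzz))) ?_
  exact Complex.ofReal_ne_zero.2 (mul_pos (Real.sqrt_pos.2 ha) (Real.sqrt_pos.2 hb)).ne'

lemma empiricalCorr_sum_mul {S : Type*} [Fintype S] (x : S → ℕ → ℂ) (w w' : S → ℂ) (n : ℕ) :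
    empiricalCorr (fun i => ∑ s, w s * x s i) (fun i => ∑ t, w' t * x t i) n =
      ∑ s, ∑ t, star (w s) * w' t * empiricalCorr (x s) (x t) n := by
  simp_rw [empiricalCorr, star_sum, Finset.sum_mul_sum, ← mul_div_assoc, Finset.mul_sum,
    ← Finset.sum_div]
  rw [Finset.sum_comm]
  congr! 2 with s
  rw [Finset.sum_comm]
  congr! 2 with t _ i
  rw [star_mul']
  ring

end NormalizedInner

section Decoder

variable {NB : ℕ} {cB cA : Codeword NB} {r : Fin NB}

lemma mem_ambiguous_observed {b : Fin NB} :
    b ∈ ambiguous (observed cB cA) ↔ cA b = !cB b := by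
  rw [ambiguous, Finset.mem_filter_univ, observed]
  cases cB b <;> cases cA b <;> decide

lemma candidate_observed {I : Fin NB → ℂ}
    (hI : ∀ b ∈ ambiguous (observed cB cA), I b ≠ 0 ↔ cB b = cB r) (a : Bool) :
    candidate (observed cB cA) I a = if a = cB r then cB else cA := by
  funext b
  have hdigit (hb : cA b = !cB b) : diffDigit (I b) = xor (cB b) (cB r) := by
    rw [diffDigit, thresholdDigit]
    simp only [norm_pos_iff, hI b (mem_ambiguous_observed.2 hb)]
    cases cB b <;> cases cB r <;> rfl
  cases hB : cB b <;> cases hA : cA b <;> cases hr : cB r <;> cases a <;>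
    simp_all [candidate, observed]

theorem separatedPair_observed {I : Fin NB → ℂ}
    (hI : ∀ b ∈ ambiguous (observed cB cA), I b ≠ 0 ↔ cB b = cB r) :
    separatedPair (observed cB cA) I = s(cB, cA) := by
  rw [separatedPair, candidate_observed hI, candidate_observed hI]
  cases cB r
  · rfl
  · exact Sym2.eq_swap

theorem separated_of_tendsto_empiricalCorr {y : Fin NB → ℕ → ℂ} {γ : Fin NB → Fin NB → ℂ}
    (hr : (ambiguous (observed cB cA)).Nonempty → r ∈ ambiguous (observed cB cA))
    (hγ : ∀ b b', Tendsto (empiricalCorr (y b) (y b')) atTop (𝓝 (γ b b')))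
    (hpos : ∀ b ∈ ambiguous (observed cB cA), 0 < (γ b b).re)
    (hne : ∀ b ∈ ambiguous (observed cB cA), γ r b ≠ 0 ↔ cB b = cB r) :
    Separated cB cA r y := by
  refine ⟨fun b => γ r b / (Real.sqrt (γ r r).re * Real.sqrt (γ b b).re : ℝ), fun b hb => ?_,
    separatedPair_observed (r := r) fun b hb => ?_⟩ <;> have hposr := hpos r (hr ⟨b, hb⟩)
  · exact tendsto_normalizedInner (hγ r b) (hγ r r) (hγ b b) hposr (hpos b hb)
  · have hsqrt := (mul_pos (Real.sqrt_pos.2 hposr) (Real.sqrt_pos.2 (hpos b hb))).ne'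
    rw [← hne b hb, Ne, div_eq_zero_iff, or_iff_left (Complex.ofReal_ne_zero.2 hsqrt)]

end Decoder

section Sources

/-- The scalar random sources heard by one antenna: the paths of Bob, those of Ava, and the
time-domain noise samples. -/
abbrev Source (N L : ℕ) : Type := (Fin L ⊕ Fin L) ⊕ Fin N

variable {N L : ℕ}

/-- Position of the source `s` at the antenna `i` in the joint family `(hB, hA, v)`. -/
def sourceIndex (s : Source N L) (i : ℕ) : (ℕ × Fin L ⊕ ℕ × Fin L) ⊕ ℕ × Fin N :=
  s.map (Sum.map (i, ·) (i, ·)) (i, ·)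

/-- Variance of a source. -/
def sourcePower (σ2 : ℝ) : Source N L → ℂ := Sum.elim (fun _ => 1 / L) fun _ => σ2

/-- Covariance of the joint family `(hB, hA, v)`. -/
def sourceCov (D Δ θB θA σ2 : ℝ) (N L : ℕ) :
    (ℕ × Fin L ⊕ ℕ × Fin L) ⊕ ℕ × Fin N → (ℕ × Fin L ⊕ ℕ × Fin L) ⊕ ℕ × Fin N → ℂ :=
  blockCov (blockCov (channelCov D Δ θB L) (channelCov D Δ θA L)) (noiseCov σ2 N)

variable {Ω : Type*} [MeasurableSpace Ω] {μ : Measure Ω} {D Δ θ θB θA σ2 : ℝ}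
  {hB hA : ℕ × Fin L → Ω → ℂ} {v : ℕ × Fin N → Ω → ℂ}

lemma isShortRange_channelCov (hD : D ≠ 0) (hΔ : 0 < Δ)
    (hcos : ∀ α ∈ Set.Icc (θ - Δ) (θ + Δ), Real.cos α ≠ 0) (l l' : Fin L) :
    IsShortRange (fun m n => channelCov D Δ θ L (m, l) (n, l')) (if l = l' then 1 / L else 0) := by
  simp only [channelCov]
  split_ifs
  · exact isShortRange_oneRing hD hΔ hcos L
  · exact .zero

lemma isShortRange_noiseCov (σ2 : ℝ) (t t' : Fin N) :
    IsShortRange (fun m n => noiseCov σ2 N (m, t) (n, t')) (if t = t' then (σ2 : ℂ) else 0) := by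
  refine ⟨fun m => by simp [noiseCov], |σ2|, fun m n => ?_⟩
  rw [noiseCov]
  split_ifs with h
  · simp [(Prod.mk.inj h).1]
  · simp

lemma isShortRange_sourceCov (hD : D ≠ 0) (hΔ : 0 < Δ)
    (hθB : ∀ α ∈ Set.Icc (θB - Δ) (θB + Δ), Real.cos α ≠ 0)
    (hθA : ∀ α ∈ Set.Icc (θA - Δ) (θA + Δ), Real.cos α ≠ 0) (s t : Source N L) :
    IsShortRange
      (fun m n => sourceCov D Δ θB θA σ2 N L (sourceIndex s m) (sourceIndex t n))
      (if s = t then sourcePower σ2 s else 0) := by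
  rcases s with (l | l) | k <;> rcases t with (l' | l') | k'
  case inl.inl.inl.inl =>
    simpa [sourceCov, sourceIndex, blockCov, sourcePower] using
      isShortRange_channelCov hD hΔ hθB l l'
  case inl.inr.inl.inr =>
    simpa [sourceCov, sourceIndex, blockCov, sourcePower] using
      isShortRange_channelCov hD hΔ hθA l l'
  case inr.inr =>
    simpa [sourceCov, sourceIndex, blockCov, sourcePower] using isShortRange_noiseCov σ2 k k'
  all_goals simpa [sourceCov, sourceIndex, blockCov] using IsShortRange.zero

lemma IsFadingModel.isCircularGaussian (h : IsFadingModel μ D Δ θB θA σ2 hB hA v) :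
    IsCircularGaussian (Sum.elim (Sum.elim hB hA) v) (sourceCov D Δ θB θA σ2 N L) μ := by
  refine (h.bob.sumElim h.ava h.indep_channels).sumElim h.noise ?_
  let join (p : (ℕ × Fin L → ℂ) × (ℕ × Fin L → ℂ)) : ℕ × Fin L ⊕ ℕ × Fin L → ℂ :=
    Sum.elim p.1 p.2
  have hjoin : Measurable join := by
    refine measurable_pi_iff.2 (Sum.rec (fun s => ?_) fun s => ?_)
    exacts [(measurable_pi_apply s).comp measurable_fst,
      (measurable_pi_apply s).comp measurable_snd]
  have hsumElim : (fun ω s => Sum.elim hB hA s ω) =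
      join ∘ fun ω => ((fun p => hB p ω), fun p => hA p ω) := by
    funext ω s
    cases s <;> rfl
  rw [hsumElim]
  exact h.indep_noise.comp hjoin measurable_id

theorem IsFadingModel.ae_tendsto_empiricalCorr_source
    (h : IsFadingModel μ D Δ θB θA σ2 hB hA v) (hD : D ≠ 0) (hΔ : 0 < Δ)
    (hθB : ∀ α ∈ Set.Icc (θB - Δ) (θB + Δ), Real.cos α ≠ 0)
    (hθA : ∀ α ∈ Set.Icc (θA - Δ) (θA + Δ), Real.cos α ≠ 0) :
    ∀ᵐ ω ∂μ, ∀ s t : Source N L, Tendsto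
      (empiricalCorr (fun i => Sum.elim (Sum.elim hB hA) v (sourceIndex s i) ω)
        fun i => Sum.elim (Sum.elim hB hA) v (sourceIndex t i) ω) atTop
      (𝓝 (if t = s then sourcePower σ2 t else 0)) := by
  have hcov := isShortRange_sourceCov (σ2 := σ2) (N := N) (L := L) hD hΔ hθB hθA
  exact ae_all_iff.2 fun s => ae_all_iff.2 fun t =>
    h.isCircularGaussian.ae_tendsto_empiricalCorr (hcov s s) (hcov t t) (hcov t s)

end Sources

section ReceivedSamples

variable {N L NB : ℕ}

/-- Weight of a source in the sample received on subcarrier `j`, when the nodes send the symbols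
`xB` and `xA` on it. -/
def sourceWeight (hLN : L ≤ N) (j : Fin N) (xB xA : ℂ) : Source N L → ℂ :=
  Sum.elim (Sum.elim (fun l => xB * dftL hLN j l) fun l => xA * dftL hLN j l) fun t => dft N j t

/-- Limit, for many antennas, of the empirical correlation between the samples on the pilot
subcarriers `Ψ b` and `Ψ b'`, where the nodes send the symbols `xB` and `xA`. -/
def limitCorr (hLN : L ≤ N) (Ψ : Fin NB → Fin N) (σ2 : ℝ) (xB xA : Fin NB → ℂ)
    (b b' : Fin NB) : ℂ :=
  (star (xB b) * xB b' + star (xA b) * xA b') / L *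
      ∑ l, star (dftL hLN (Ψ b) l) * dftL hLN (Ψ b') l +
    if Ψ b = Ψ b' then (σ2 : ℂ) else 0

variable {Ω : Type*} (hLN : L ≤ N) {σ2 : ℝ}

lemma received_eq_sum (j : Fin N) (xB xA : ℂ) (hB hA : ℕ × Fin L → Ω → ℂ)
    (v : ℕ × Fin N → Ω → ℂ) (ω : Ω) (i : ℕ) :
    received hLN j xB xA (fun l => hB (i, l) ω) (fun l => hA (i, l) ω) (fun t => v (i, t) ω) =
      ∑ s, sourceWeight hLN j xB xA s * Sum.elim (Sum.elim hB hA) v (sourceIndex s i) ω := by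
  simp only [received, Matrix.mulVec, dotProduct, Fintype.sum_sum_type, sourceWeight,
    Sum.elim_inl, Sum.elim_inr, sourceIndex, Sum.map_inl, Sum.map_inr, Finset.mul_sum, mul_assoc]

lemma sum_sourceWeight_eq_limitCorr (Ψ : Fin NB → Fin N) (σ2 : ℝ) (xB xA : Fin NB → ℂ)
    (b b' : Fin NB) :
    ∑ s, ∑ t, star (sourceWeight hLN (Ψ b) (xB b) (xA b) s) *
        sourceWeight hLN (Ψ b') (xB b') (xA b') t * (if t = s then sourcePower σ2 t else 0) =
      limitCorr hLN Ψ σ2 xB xA b b' := by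
  have hnoise : ∑ t, star (dft N (Ψ b) t) * dft N (Ψ b') t * σ2 =
      if Ψ b = Ψ b' then (σ2 : ℂ) else 0 := by
    rw [← Finset.sum_mul, sum_star_dft_mul, ite_mul, one_mul, zero_mul]
  simp only [mul_ite, mul_zero, Finset.sum_ite_eq', Finset.mem_univ, if_true,
    Fintype.sum_sum_type, sourceWeight, sourcePower, Sum.elim_inl, Sum.elim_inr]
  rw [hnoise, limitCorr, Finset.mul_sum, ← Finset.sum_add_distrib]
  congr! 2 with l
  rw [star_mul', star_mul']
  ring

theorem IsFadingModel.ae_tendsto_empiricalCorr_sample [MeasurableSpace Ω] {μ : Measure Ω}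
    {D Δ θB θA : ℝ} {hB hA : ℕ × Fin L → Ω → ℂ} {v : ℕ × Fin N → Ω → ℂ}
    (h : IsFadingModel μ D Δ θB θA σ2 hB hA v) (hD : D ≠ 0) (hΔ : 0 < Δ)
    (hθB : ∀ α ∈ Set.Icc (θB - Δ) (θB + Δ), Real.cos α ≠ 0)
    (hθA : ∀ α ∈ Set.Icc (θA - Δ) (θA + Δ), Real.cos α ≠ 0) (Ψ : Fin NB ↪ Fin N) (ρB ρA : ℝ)
    (cB cA : Codeword NB) (φB : Ω → ℝ) (φA : Fin NB → Ω → ℝ) :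
    ∀ᵐ ω ∂μ, ∀ b b', Tendsto
      (empiricalCorr (sample hLN Ψ ρB ρA cB cA φB φA hB hA v b ω)
        (sample hLN Ψ ρB ρA cB cA φB φA hB hA v b' ω)) atTop
      (𝓝 (limitCorr hLN Ψ σ2 (fun b => pilot (cB b) ρB (φB ω)) (fun b => pilot (cA b) ρA (φA b ω))
        b b')) := by
  filter_upwards [h.ae_tendsto_empiricalCorr_source hD hΔ hθB hθA] with ω hω b b'
  unfold sample
  simp_rw [received_eq_sum, ← sum_sourceWeight_eq_limitCorr]
  rw [funext (empiricalCorr_sum_mul _ _ _)]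
  exact tendsto_finsetSum _ fun s _ => tendsto_finsetSum _ fun t _ => (hω s t).const_mul _

variable {xB xA : Fin NB → ℂ} {cB cA : Codeword NB}

lemma limitCorr_self (hL : 0 < L) (Ψ : Fin NB → Fin N) (σ2 : ℝ) (xB xA : Fin NB → ℂ)
    (b : Fin NB) :
    limitCorr hLN Ψ σ2 xB xA b b = ((‖xB b‖ ^ 2 + ‖xA b‖ ^ 2 + σ2 : ℝ) : ℂ) := by
  have hL' : (L : ℂ) ≠ 0 := by exact_mod_cast hL.ne'
  rw [limitCorr, sum_star_dftL_mul_self, div_mul_cancel₀ _ hL', if_pos rfl]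
  simp [Complex.conj_mul']

lemma limitCorr_self_re_pos (hL : 0 < L) (Ψ : Fin NB → Fin N) (hσ : 0 ≤ σ2)
    (hxB : ∀ b, xB b ≠ 0 ↔ cB b = true) (hxA : ∀ b, xA b ≠ 0 ↔ cA b = true) {b : Fin NB}
    (hb : b ∈ ambiguous (observed cB cA)) : 0 < (limitCorr hLN Ψ σ2 xB xA b b).re := by
  rw [limitCorr_self hLN hL, Complex.ofReal_re]
  rw [mem_ambiguous_observed] at hb
  cases hc : cB b
  · have := norm_pos_iff.2 ((hxA b).2 (by rw [hb, hc]; rfl))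
    positivity
  · have := norm_pos_iff.2 ((hxB b).2 hc)
    positivity

lemma star_mul_add_star_mul_ne_zero_iff (hxB : ∀ b, xB b ≠ 0 ↔ cB b = true)
    (hxA : ∀ b, xA b ≠ 0 ↔ cA b = true) {r b : Fin NB} (hr : r ∈ ambiguous (observed cB cA))
    (hb : b ∈ ambiguous (observed cB cA)) :
    star (xB r) * xB b + star (xA r) * xA b ≠ 0 ↔ cB b = cB r := by
  rw [mem_ambiguous_observed] at hr hb
  have hBr := hxB r
  have hBb := hxB b
  have hAr := hxA r
  have hAb := hxA b
  rw [hr] at hAr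
  rw [hb] at hAb
  revert hBr hBb hAr hAb
  cases cB r <;> cases cB b <;> simp +contextual

lemma limitCorr_ne_zero_iff (hL : 0 < L) (hσ : 0 ≤ σ2) (Ψ : Fin NB ↪ Fin N)
    (hxB : ∀ b, xB b ≠ 0 ↔ cB b = true) (hxA : ∀ b, xA b ≠ 0 ↔ cA b = true) {r b : Fin NB}
    (hr : r ∈ ambiguous (observed cB cA)) (hb : b ∈ ambiguous (observed cB cA))
    (hres : b ≠ r → cB b = cB r → ¬ (N : ℤ) ∣ (L : ℤ) * ((Ψ r : ℤ) - Ψ b)) :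
    limitCorr hLN Ψ σ2 xB xA r b ≠ 0 ↔ cB b = cB r := by
  rcases eq_or_ne b r with rfl | hbr
  · have hpos := limitCorr_self_re_pos hLN hL Ψ hσ hxB hxA hb
    exact iff_of_true (fun h => by simp [h] at hpos) rfl
  have hΨ : Ψ r ≠ Ψ b := Ψ.injective.ne hbr.symm
  rw [limitCorr, if_neg hΨ, add_zero, mul_ne_zero_iff, div_ne_zero_iff,
    star_mul_add_star_mul_ne_zero_iff hxB hxA hr hb, Nat.cast_ne_zero]
  exact ⟨fun h => h.1.1, fun h => ⟨⟨h, hL.ne'⟩, sum_star_dftL_mul_ne_zero hLN hΨ (hres hbr h)⟩⟩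

lemma pilot_ne_zero_iff {ρ : ℝ} (hρ : 0 < ρ) (φ : ℝ) (digit : Bool) :
    pilot digit ρ φ ≠ 0 ↔ digit = true := by
  cases digit <;> simp [pilot, Real.sqrt_ne_zero'.2 hρ]

end ReceivedSamples

lemma cos_ne_zero_of_mem_Icc {a b : ℝ} (ha : -(Real.pi / 3) ≤ a) (hb : b ≤ Real.pi / 3) :
    ∀ α ∈ Set.Icc a b, Real.cos α ≠ 0 := fun α hα =>
  (Real.cos_pos_of_mem_Ioo ⟨by linarith [hα.1, Real.pi_pos], by linarith [hα.2, Real.pi_pos]⟩).ne'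

end ICC

end

theorem proposition2_general {Ω : Type*} [MeasurableSpace Ω] (μ : Measure Ω)
    {N L NB : ℕ} (hL : 0 < L) (hLN : L ≤ N) (Ψ : Fin NB ↪ Fin N)
    (D Δ θB θA σ2 ρB ρA : ℝ) (hD : D ≠ 0) (hΔ : 0 < Δ)
    (hθB : ∀ α ∈ Set.Icc (θB - Δ) (θB + Δ), Real.cos α ≠ 0)
    (hθA : ∀ α ∈ Set.Icc (θA - Δ) (θA + Δ), Real.cos α ≠ 0)
    (hσ : 0 ≤ σ2) (hρB : 0 < ρB) (hρA : 0 < ρA)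
    (hB hA : ℕ × Fin L → Ω → ℂ) (v : ℕ × Fin N → Ω → ℂ)
    (hmodel : ICC.IsFadingModel μ D Δ θB θA σ2 hB hA v)
    (φB : Ω → ℝ) (φA : Fin NB → Ω → ℝ)
    (cB cA : ICC.Codeword NB) (r : Fin NB)
    (hr : (ICC.ambiguous (ICC.observed cB cA)).Nonempty →
      r ∈ ICC.ambiguous (ICC.observed cB cA))
    (hres : ∀ b ∈ ICC.ambiguous (ICC.observed cB cA), b ≠ r → cB b = cB r →
      ¬ (N : ℤ) ∣ (L : ℤ) * (((Ψ r : ℕ) : ℤ) - ((Ψ b : ℕ) : ℤ))) :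
    ICC.sep μ cB cA r (ICC.sample hLN Ψ ρB ρA cB cA φB φA hB hA v) = 0 := by
  rw [ICC.sep, ← ae_iff]
  filter_upwards [hmodel.ae_tendsto_empiricalCorr_sample hLN hD hΔ hθB hθA Ψ ρB ρA cB cA φB φA]
    with ω hlimit
  have hxB b := ICC.pilot_ne_zero_iff hρB (φB ω) (cB b)
  have hxA b := ICC.pilot_ne_zero_iff hρA (φA b ω) (cA b)
  exact ICC.separated_of_tendsto_empiricalCorr hr hlimit
    (fun b hb => ICC.limitCorr_self_re_pos hLN hL Ψ hσ hxB hxA hb)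
    (fun b hb => ICC.limitCorr_ne_zero_iff hLN hL hσ Ψ hxB hxA (hr ⟨b, hb⟩) hb (hres b hb))

theorem proposition2 {Ω : Type*} [MeasurableSpace Ω] (μ : Measure Ω) [IsProbabilityMeasure μ]
    {N L NB : ℕ} (hL : 0 < L) (hLN : L ≤ N) (Ψ : Fin NB ↪ Fin N)
    (D Δ θB θA σ2 ρB ρA : ℝ) (hD : 0 < D) (hΔ : 0 < Δ)
    (hθB : -(Real.pi / 3) ≤ θB - Δ ∧ θB + Δ ≤ Real.pi / 3)
    (hθA : -(Real.pi / 3) ≤ θA - Δ ∧ θA + Δ ≤ Real.pi / 3)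
    (hσ : 0 ≤ σ2) (hρB : 0 < ρB) (hρA : 0 < ρA)
    (hB hA : ℕ × Fin L → Ω → ℂ) (v : ℕ × Fin N → Ω → ℂ)
    (hmodel : ICC.IsFadingModel μ D Δ θB θA σ2 hB hA v)
    (φB : Ω → ℝ) (φA : Fin NB → Ω → ℝ)
    (cB cA : ICC.Codeword NB) (r : Fin NB)
    (hr : (ICC.ambiguous (ICC.observed cB cA)).Nonempty →
      r ∈ ICC.ambiguous (ICC.observed cB cA))
    (hres : ∀ b ∈ ICC.ambiguous (ICC.observed cB cA), b ≠ r → cB b = cB r →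
      ¬ (N : ℤ) ∣ (L : ℤ) * (((Ψ r : ℕ) : ℤ) - ((Ψ b : ℕ) : ℤ))) :
    ICC.sep μ cB cA r (ICC.sample hLN Ψ ρB ρA cB cA φB φA hB hA v) = 0 := by
  exact proposition2_general μ hL hLN Ψ D Δ θB θA σ2 ρB ρA hD.ne' hΔ
    (ICC.cos_ne_zero_of_mem_Icc hθB.1 hθB.2) (ICC.cos_ne_zero_of_mem_Icc hθA.1 hθA.2) hσ hρB hρA
    hB hA v hmodel φB φA cB cA r hr hres
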